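/- Let $\mathsf X$ be a non-compact Polish space with its Borel $\sigma$-algebra. Let $(M_n)_{n\ge1}$ be Markov kernels on $\mathsf X$, let $(G_n)_{n\ge0}$ be measurable, strictly positive, real-valued functions on $\mathsf X$, and put $Q_n(x,dx')=G_{n-1}(x)M_n(x,dx')$ for $n\ge1$, $Q_{p,n}=Q_{p+1}\cdots Q_n$ for $0\le p<n$, and $Q_{n,n}=\mathrm{Id}$. Let $\mu$ be a probability measure on $\mathsf X$. For a kernel $K$, a measure $\eta$ and a function $\varphi$ write $K(\varphi)(x)=\int\varphi(y)\,K(x,dy)$ and $\eta(\varphi)=\int\varphi\,d\eta$. Assume: (H1) $V:\mathsf X\to[1,\infty)$ is measurable and unbounded, $\delta>0$, $\underline d\ge1$, and for each $d\in[\underline d,\infty)$ there is $b_d<\infty$ such that, with $C_d=\{x:V(x)\le d\}$, $$\sup_{n\ge1}Q_n(e^V)(x)\le\exp\big(V(x)(1-\delta)+b_d\mathbb I_{C_d}(x)\big)\quad\text{for all }x\in\mathsf X.$$ (H2) $\mu\in\mathcal P_v$, where $v=e^V$ and $\mathcal P_v$ is the set of probability measures $\eta$ with $\eta(v)<\infty$.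 (H3) For each $d\in[\underline d,\infty)$: $Q_n(x,C_d)>0$ for all $x\in\mathsf X$ and $n\ge1$, and there are $\epsilon_d^->0$ and $\nu_d\in\mathcal P_v$ such that $\inf_{n\ge1}Q_n(x,C_d\cap A)\ge\epsilon_d^-\nu_d(C_d\cap A)$ for all $x\in C_d$ and all measurable $A$, and $\nu_d(C_r)>0$ for all $r\in[\underline d,d]$. (H4) For each $d\in[\underline d,\infty)$ there is $\epsilon_d^+\in[\epsilon_d^-,\infty)$ such that $\sup_{n\ge1}Q_n(x,C_d\cap A)\le\epsilon_d^+\nu_d(C_d\cap A)$ for all $x\in C_d$ and all measurable $A$. Let $\gamma_n=\mu Q_{0,n}$, $\eta_n=\gamma_n/\gamma_n(1)$, $\lambda_n=\eta_n(G_n)$ and $h_{p,n}(x)=Q_{p,n}(1)(x)/\prod_{q=p}^{n-1}\lambda_q$ for $0\le p\le n$. Let $\|\varphi\|_v=\sup_x|\varphi(x)|/v(x)$, and let $\mathcal L_v$ be the set of measurable $\varphi:\mathsf X\to\mathbb R$ with $\|\varphi\|_v<\infty$. Then there exist $\rho\in[0,1)$ and $c_\mu<\infty$, depending only on $\mu$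 and on the data $V,\delta,\underline d,(b_d),(\epsilon_d^-),(\nu_d),(\epsilon_d^+)$ of the assumptions (and not otherwise on the sequences $(M_n)$ and $(G_n)$), such that the following holds. All $\lambda_n$ are strictly positive, and for every $\varphi\in\mathcal L_v$, $n\ge1$, $0\le p<n$ and $x\in\mathsf X$, $\varphi$ is integrable with respect to $Q_{p,n}(x,\cdot)$ and $\eta_n$, and $$\left|\frac{Q_{p,n}(\varphi)(x)}{\prod_{q=p}^{n-1}\lambda_q}-h_{p,n}(x)\,\eta_n(\varphi)\right|\le\rho^{\,n-p}\,\|\varphi\|_v\,c_\mu\,v(x)\,\mu(v).$$ -/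

import Mathlib

open MeasureTheory ProbabilityTheory
open scoped ENNReal

noncomputable section

/-- A Feynman-Kac model on `X`: Markov kernels `M n` (only the indices `n ≥ 1` are used) and
measurable, strictly positive, real-valued potential functions `G n`, `n ≥ 0`. -/
structure FKModel (X : Type*) [MeasurableSpace X] where
  M : ℕ → Kernel X X
  markov : ∀ n, IsMarkovKernel (M n)
  G : ℕ → X → ℝ
  measurable_G : ∀ n, Measurable (G n)
  G_pos : ∀ n x, 0 < G n x

namespace FKModel

variable {X : Type*} [MeasurableSpace X]

/-- The kernel `Q_n(x, dx') = G_{n-1}(x) M_n(x, dx')` for `n ≥ 1`; there is no `Q_0` and the value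
at `0` is a placeholder that is never used. -/
def Q (F : FKModel X) : ℕ → Kernel X X
  | 0 => 0
  | n + 1 =>
    { toFun := fun x => ENNReal.ofReal (F.G n x) • F.M (n + 1) x
      measurable' := by
        refine Measure.measurable_of_measurable_coe _ fun s hs => ?_
        simp only [Measure.smul_apply, smul_eq_mul]
        exact ((F.measurable_G n).ennreal_ofReal).mul ((F.M (n + 1)).measurable_coe hs) }

/-- The semigroup `Q_{p,n} = Q_{p+1} ⋯ Q_n` for `p < n`, with `Q_{n,n} = Id`
(and `Q_{p,n} = Id` for `p > n`). `κ' ∘ₖ κ` is the composition that moves by `κ` first. -/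
def semigroup (F : FKModel X) (p : ℕ) : ℕ → Kernel X X
  | 0 => Kernel.id
  | n + 1 => if p ≤ n then F.Q (n + 1) ∘ₖ F.semigroup p n else Kernel.id

/-- `Q_{p,n}(φ)(x) = ∫ φ(y) Q_{p,n}(x, dy)`. -/
def semigroupOp (F : FKModel X) (p n : ℕ) (φ : X → ℝ) (x : X) : ℝ :=
  ∫ y, φ y ∂(F.semigroup p n x)

/-- The unnormalised measures `γ_n = μ Q_{0,n}`. -/
def gamma (F : FKModel X) (μ : Measure X) (n : ℕ) : Measure X :=
  μ.bind (F.semigroup 0 n)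

/-- The normalised measures `η_n = γ_n / γ_n(1)`. -/
def eta (F : FKModel X) (μ : Measure X) (n : ℕ) : Measure X :=
  (F.gamma μ n Set.univ)⁻¹ • F.gamma μ n

/-- `λ_n = η_n(G_n)`. -/
def lam (F : FKModel X) (μ : Measure X) (n : ℕ) : ℝ :=
  ∫ x, F.G n x ∂(F.eta μ n)

/-- `h_{p,n}(x) = Q_{p,n}(1)(x) / ∏_{q=p}^{n-1} λ_q`; it equals `1` when `p = n`. -/
def h (F : FKModel X) (μ : Measure X) (p n : ℕ) (x : X) : ℝ :=
  F.semigroupOp p n (fun _ => 1) x / ∏ q ∈ Finset.Ico p n, F.lam μ q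

end FKModel

/-- The weighting function `v = e^V`. -/
def expWeight {X : Type*} (V : X → ℝ) (x : X) : ℝ := Real.exp (V x)

/-- The sublevel set `C_d = {x | V x ≤ d}`. -/
def sublevel {X : Type*} (V : X → ℝ) (d : ℝ) : Set X := {x | V x ≤ d}

/-- The weighted norm `‖φ‖_v = sup_x |φ x| / v x`, for `φ ∈ L_v`. -/
def vNorm {X : Type*} (v φ : X → ℝ) : ℝ := ⨆ x, |φ x| / v x

/-- `φ ∈ L_v`: `φ` is measurable and `sup_x |φ x| / v x < ∞`. -/
def MemLv {X : Type*} [MeasurableSpace X] (v φ : X → ℝ) : Prop :=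
  Measurable φ ∧ BddAbove (Set.range fun x => |φ x| / v x)

/-- `η ∈ P_v`: `η` is a probability measure with `η(v) < ∞`. -/
def MemPv {X : Type*} [MeasurableSpace X] (v : X → ℝ) (η : Measure X) : Prop :=
  IsProbabilityMeasure η ∧ ∫⁻ x, ENNReal.ofReal (v x) ∂η < ∞

/-- The multiplicative drift condition, with drift function `V` and constants `δ`, `d₀` and
`b d` for `d ≥ d₀`. -/
structure DriftCondition {X : Type*} [MeasurableSpace X] (F : FKModel X)
    (V : X → ℝ) (δ d₀ : ℝ) (b : ℝ → ℝ) : Prop where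
  measurable_V : Measurable V
  one_le_V : ∀ x, 1 ≤ V x
  unbounded_V : ¬ BddAbove (Set.range V)
  delta_pos : 0 < δ
  one_le_d₀ : 1 ≤ d₀
  drift : ∀ d, d₀ ≤ d → ∀ n, 1 ≤ n → ∀ x,
    ∫⁻ y, ENNReal.ofReal (expWeight V y) ∂(F.Q n x) ≤
      ENNReal.ofReal (Real.exp
        (V x * (1 - δ) + b d * (sublevel V d).indicator (fun _ => (1 : ℝ)) x))

/-- Accessibility of the sublevel sets and the time-uniform local minorization. -/
structure MinorizationCondition {X : Type*} [MeasurableSpace X] (F : FKModel X)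
    (V : X → ℝ) (d₀ : ℝ) (εm : ℝ → ℝ) (ν : ℝ → Measure X) : Prop where
  accessible : ∀ d, d₀ ≤ d → ∀ n, 1 ≤ n → ∀ x, 0 < F.Q n x (sublevel V d)
  eps_pos : ∀ d, d₀ ≤ d → 0 < εm d
  nu_mem : ∀ d, d₀ ≤ d → MemPv (expWeight V) (ν d)
  minor : ∀ d, d₀ ≤ d → ∀ n, 1 ≤ n → ∀ x ∈ sublevel V d, ∀ A, MeasurableSet A →
    ENNReal.ofReal (εm d) * ν d (sublevel V d ∩ A) ≤ F.Q n x (sublevel V d ∩ A)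
  nu_pos : ∀ d, d₀ ≤ d → ∀ r ∈ Set.Icc d₀ d, 0 < ν d (sublevel V r)

/-- The time-uniform local majorization. -/
structure MajorizationCondition {X : Type*} [MeasurableSpace X] (F : FKModel X)
    (V : X → ℝ) (d₀ : ℝ) (εm : ℝ → ℝ) (ν : ℝ → Measure X) (εp : ℝ → ℝ) : Prop where
  eps_le : ∀ d, d₀ ≤ d → εm d ≤ εp d
  major : ∀ d, d₀ ≤ d → ∀ n, 1 ≤ n → ∀ x ∈ sublevel V d, ∀ A, MeasurableSet A →
    F.Q n x (sublevel V d ∩ A) ≤ ENNReal.ofReal (εp d) * ν d (sublevel V d ∩ A)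

end

/-! Put `h_{p,n} = Q_{p,n}(1) / ∏ λ_q`. Since `λ_p h_{p,n} = Q_{p+1}(h_{p+1,n})`, the kernels
`Q_{p+1}(x,dy) h_{p+1,n}(y) / (λ_p h_{p,n}(x))` are Markov, and the theorem is a Harris-type
contraction for them. To avoid dividing by `h`, the contraction is stated for `f = Q_{p,n}(φ) / ∏
λ_q` itself: if `|f - c h| ≤ A (h + β v)` at time `p + 1`, the same holds at time `p` with some
other `c` and with `α A` for `A`, where `α < 1` (`exists_abs_sub_mul_le_of_drift_of_minorization`,
iterated in `exists_abs_normOp_sub_le`).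

The drift and minorization of the twisted kernels must be uniform in `p` and `n`. This needs `λ_n`
bounded below, `h_{p,n} ≤ D v` everywhere and `h_{p,n} ≥ 1/D` on a fixed sublevel set `C_r`. Two
estimates supply these. Forward in time, `γ_n(v) ≤ B γ_n(C_r)` (`integral_gamma_le_mul_real`).
Backward in time, `Q_{p,n}(1)` is at most `A v` times a lower bound for itself on `C_r`
(`exists_semigroupOp_one_bounds`, where the majorization enters). Both rest on the multiplicative
drift: off `C_d` one has `Q(v) ≤ e^{-δd} v`, a factor as small as desired for large `d`.

Finally `c` is replaced by `η_n(φ)` by integrating against `η_p`, because `η_p(h_{p,n}) = 1` and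
`η_p(f) = η_n(φ)` (`abs_normOp_sub_integral_eta_le`). -/

namespace FKModel

variable {X : Type*} [MeasurableSpace X]

/-! ### Algebra of the semigroup and of the unnormalised flow. -/

lemma Q_succ_apply (F : FKModel X) (n : ℕ) (x : X) :
    F.Q (n + 1) x = ENNReal.ofReal (F.G n x) • F.M (n + 1) x := rfl

instance isFiniteMeasure_Q (F : FKModel X) (n : ℕ) (x : X) : IsFiniteMeasure (F.Q n x) := by
  cases n with
  | zero => rw [show F.Q 0 = 0 from rfl, zero_apply]; infer_instance
  | succ n =>
    have := F.markov (n + 1)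
    rw [Q_succ_apply]
    exact Measure.smul_finite _ ENNReal.ofReal_ne_top

lemma Q_succ_apply_univ (F : FKModel X) (n : ℕ) (x : X) :
    F.Q (n + 1) x Set.univ = ENNReal.ofReal (F.G n x) := by
  have := F.markov (n + 1)
  simp [Q_succ_apply]

lemma Q_succ_real_univ (F : FKModel X) (n : ℕ) (x : X) :
    (F.Q (n + 1) x).real Set.univ = F.G n x := by
  rw [measureReal_def, Q_succ_apply_univ, ENNReal.toReal_ofReal (F.G_pos n x).le]

lemma semigroup_self (F : FKModel X) (n : ℕ) : F.semigroup n n = Kernel.id := by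
  -- For a successor this is the `else` branch of the definition, as `n + 1 ≤ n` fails.
  cases n <;> simp [semigroup]

lemma semigroup_succ (F : FKModel X) {p n : ℕ} (h : p ≤ n) :
    F.semigroup p (n + 1) = F.Q (n + 1) ∘ₖ F.semigroup p n := by
  simp [semigroup, h]

/-- The definition composes at the final time; the inductions that run backward in `p` need the
first factor split off instead. -/
lemma semigroup_succ_left (F : FKModel X) {p n : ℕ} (h : p < n) :
    F.semigroup p n = F.semigroup (p + 1) n ∘ₖ F.Q (p + 1) := by
  induction n, h using Nat.le_induction with
  | base => rw [semigroup_succ F le_rfl, semigroup_self, semigroup_self, Kernel.comp_id,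
      Kernel.id_comp]
  | succ n h ih => rw [semigroup_succ F (by lia), semigroup_succ F h, ih, Kernel.comp_assoc]

lemma gamma_zero (F : FKModel X) (μ : Measure X) : F.gamma μ 0 = μ := by
  rw [gamma, semigroup_self, Measure.id_comp]

lemma gamma_succ (F : FKModel X) (μ : Measure X) (n : ℕ) :
    F.gamma μ (n + 1) = F.Q (n + 1) ∘ₘ F.gamma μ n := by
  rw [gamma, gamma, semigroup_succ F (Nat.zero_le n), Measure.comp_assoc]

lemma gamma_eq_semigroup_comp (F : FKModel X) (μ : Measure X) {p n : ℕ} (h : p ≤ n) :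
    F.gamma μ n = F.semigroup p n ∘ₘ F.gamma μ p := by
  induction n, h using Nat.le_induction with
  | base => rw [semigroup_self, Measure.id_comp]
  | succ n h ih => rw [semigroup_succ F h, gamma_succ, ih, Measure.comp_assoc]

lemma semigroupOp_self (F : FKModel X) (n : ℕ) {φ : X → ℝ} (hφ : Measurable φ) (x : X) :
    F.semigroupOp n n φ x = φ x := by
  rw [semigroupOp, semigroup_self, Kernel.id_apply, integral_dirac' _ _ hφ.stronglyMeasurable]

lemma semigroupOp_succ_left (F : FKModel X) {p n : ℕ} (h : p < n) {φ : X → ℝ} {x : X}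
    (hφ : Integrable φ (F.semigroup p n x)) :
    F.semigroupOp p n φ x = ∫ y, F.semigroupOp (p + 1) n φ y ∂(F.Q (p + 1) x) := by
  rw [semigroup_succ_left F h] at hφ
  simp only [semigroupOp]
  rw [semigroup_succ_left F h, Kernel.integral_comp hφ]

lemma integrable_semigroupOp_Q (F : FKModel X) {p n : ℕ} (h : p < n) {φ : X → ℝ} {x : X}
    (hφ : Integrable φ (F.semigroup p n x)) :
    Integrable (F.semigroupOp (p + 1) n φ) (F.Q (p + 1) x) := by
  rw [semigroup_succ_left F h] at hφ
  exact hφ.integral_comp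

lemma integrable_semigroupOp_gamma (F : FKModel X) (μ : Measure X) {p n : ℕ} (h : p ≤ n)
    {φ : X → ℝ} (hφ : Integrable φ (F.gamma μ n)) :
    Integrable (F.semigroupOp p n φ) (F.gamma μ p) := by
  rw [gamma_eq_semigroup_comp F μ h, Measure.comp_eq_comp_const_apply] at hφ
  have h := hφ.integral_comp
  rwa [Kernel.const_apply] at h

lemma integral_gamma_eq (F : FKModel X) (μ : Measure X) {p n : ℕ} (h : p ≤ n)
    {φ : X → ℝ} (hφ : Integrable φ (F.gamma μ n)) :
    ∫ y, φ y ∂(F.gamma μ n) = ∫ y, F.semigroupOp p n φ y ∂(F.gamma μ p) := by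
  rw [gamma_eq_semigroup_comp F μ h, Measure.comp_eq_comp_const_apply] at hφ ⊢
  rw [Kernel.integral_comp hφ, Kernel.const_apply]
  rfl

end FKModel

lemma expWeight_pos {X : Type*} (V : X → ℝ) (x : X) : 0 < expWeight V x := Real.exp_pos _

/-! ### Consequences of the drift condition. -/

section Drift

variable {X : Type*} [MeasurableSpace X] {F : FKModel X} {V : X → ℝ} {δ d₀ : ℝ} {b : ℝ → ℝ}

lemma measurableSet_sublevel (hV : Measurable V) (d : ℝ) : MeasurableSet (sublevel V d) :=
  measurableSet_le hV measurable_const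

namespace DriftCondition

lemma measurable_expWeight (hD : DriftCondition F V δ d₀ b) : Measurable (expWeight V) :=
  hD.measurable_V.exp

lemma one_le_expWeight (hD : DriftCondition F V δ d₀ b) (x : X) : 1 ≤ expWeight V x :=
  Real.one_le_exp (by linarith [hD.one_le_V x])

/-- The sign of `b d` is not known; `|b d|` gives one bound valid on and off `C_d`. -/
lemma lintegral_Q_le (hD : DriftCondition F V δ d₀ b) {d : ℝ} (hd : d₀ ≤ d) (n : ℕ) (x : X) :
    ∫⁻ y, ENNReal.ofReal (expWeight V y) ∂(F.Q (n + 1) x) ≤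
      ENNReal.ofReal (Real.exp |b d| * Real.exp (V x * (1 - δ))) := by
  refine (hD.drift d hd (n + 1) (by lia) x).trans (ENNReal.ofReal_le_ofReal ?_)
  rw [← Real.exp_add]
  apply Real.exp_le_exp.2
  by_cases hx : x ∈ sublevel V d
  · simp only [hx, Set.indicator_of_mem]; linarith [le_abs_self (b d)]
  · simp only [hx, not_false_eq_true, Set.indicator_of_notMem]; linarith [abs_nonneg (b d)]

lemma integrable_Q (hD : DriftCondition F V δ d₀ b) (n : ℕ) (x : X) :
    Integrable (expWeight V) (F.Q (n + 1) x) :=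
  lintegral_ofReal_ne_top_iff_integrable hD.measurable_expWeight.aestronglyMeasurable
    (.of_forall fun _ => (expWeight_pos V _).le) |>.1
    ((hD.lintegral_Q_le le_rfl n x).trans_lt ENNReal.ofReal_lt_top).ne

lemma integral_Q_le_of_lintegral (hD : DriftCondition F V δ d₀ b) (n : ℕ) (x : X) {c : ℝ}
    (hc : 0 ≤ c) (h : ∫⁻ y, ENNReal.ofReal (expWeight V y) ∂(F.Q (n + 1) x) ≤ ENNReal.ofReal c) :
    ∫ y, expWeight V y ∂(F.Q (n + 1) x) ≤ c := by
  rw [← ofReal_integral_eq_lintegral_ofReal (hD.integrable_Q n x)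
    (.of_forall fun _ => (expWeight_pos V _).le)] at h
  exact (ENNReal.ofReal_le_ofReal_iff hc).1 h

lemma integral_Q_le_exp (hD : DriftCondition F V δ d₀ b) {d : ℝ} (hd : d₀ ≤ d) (n : ℕ) (x : X) :
    ∫ y, expWeight V y ∂(F.Q (n + 1) x) ≤ Real.exp |b d| * Real.exp (V x * (1 - δ)) :=
  hD.integral_Q_le_of_lintegral n x (by positivity) (hD.lintegral_Q_le hd n x)

lemma integral_Q_le (hD : DriftCondition F V δ d₀ b) {d : ℝ} (hd : d₀ ≤ d) (n : ℕ) (x : X) :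
    ∫ y, expWeight V y ∂(F.Q (n + 1) x) ≤ Real.exp |b d| * expWeight V x := by
  refine (hD.integral_Q_le_exp hd n x).trans ?_
  unfold expWeight
  gcongr
  nlinarith [hD.one_le_V x, hD.delta_pos]

/-- Off `C_d` the bound is `e^{V(1-δ)} = e^{-δV} v` with `V > d`. Every smallness requirement below
is met by raising `d` here. -/
lemma integral_Q_le_of_notMem (hD : DriftCondition F V δ d₀ b) {d : ℝ} (hd : d₀ ≤ d) (n : ℕ)
    {x : X} (hx : x ∉ sublevel V d) :
    ∫ y, expWeight V y ∂(F.Q (n + 1) x) ≤ Real.exp (-(δ * d)) * expWeight V x := by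
  refine hD.integral_Q_le_of_lintegral n x (mul_pos (Real.exp_pos _) (expWeight_pos V x)).le
    ((hD.drift d hd (n + 1) (by lia) x).trans (ENNReal.ofReal_le_ofReal ?_))
  rw [expWeight, ← Real.exp_add]
  apply Real.exp_le_exp.2
  have : d < V x := not_le.1 hx
  simp only [hx, not_false_eq_true, Set.indicator_of_notMem]
  nlinarith [hD.delta_pos]

lemma lintegral_comp_lt_top (hD : DriftCondition F V δ d₀ b) (n : ℕ) {η : Measure X}
    (hη : ∫⁻ y, ENNReal.ofReal (expWeight V y) ∂η < ∞) :
    ∫⁻ y, ENNReal.ofReal (expWeight V y) ∂(F.Q (n + 1) ∘ₘ η) < ∞ := by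
  rw [Measure.lintegral_bind (Kernel.aemeasurable _)
    hD.measurable_expWeight.ennreal_ofReal.aemeasurable]
  calc ∫⁻ x, ∫⁻ y, ENNReal.ofReal (expWeight V y) ∂(F.Q (n + 1) x) ∂η
      ≤ ∫⁻ x, ENNReal.ofReal (Real.exp |b d₀|) * ENNReal.ofReal (expWeight V x) ∂η := by
        refine lintegral_mono fun x => ?_
        rw [← ENNReal.ofReal_mul (Real.exp_pos _).le]
        refine (hD.lintegral_Q_le le_rfl n x).trans (ENNReal.ofReal_le_ofReal ?_)
        unfold expWeight
        gcongr
        nlinarith [hD.one_le_V x, hD.delta_pos]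
    _ = ENNReal.ofReal (Real.exp |b d₀|) * ∫⁻ x, ENNReal.ofReal (expWeight V x) ∂η :=
        lintegral_const_mul _ hD.measurable_expWeight.ennreal_ofReal
    _ < ∞ := ENNReal.mul_lt_top ENNReal.ofReal_lt_top hη

lemma lintegral_semigroup_lt_top (hD : DriftCondition F V δ d₀ b) {p n : ℕ} (h : p ≤ n) (x : X) :
    ∫⁻ y, ENNReal.ofReal (expWeight V y) ∂(F.semigroup p n x) < ∞ := by
  induction n, h using Nat.le_induction with
  | base =>
    rw [F.semigroup_self, Kernel.id_apply,
      lintegral_dirac' _ hD.measurable_expWeight.ennreal_ofReal]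
    exact ENNReal.ofReal_lt_top
  | succ n h ih =>
    rw [F.semigroup_succ h, Kernel.comp_apply]
    exact hD.lintegral_comp_lt_top n ih

lemma lintegral_gamma_lt_top (hD : DriftCondition F V δ d₀ b) {μ : Measure X}
    (hμ : MemPv (expWeight V) μ) (n : ℕ) :
    ∫⁻ y, ENNReal.ofReal (expWeight V y) ∂(F.gamma μ n) < ∞ := by
  induction n with
  | zero => rw [F.gamma_zero]; exact hμ.2
  | succ n ih => rw [F.gamma_succ]; exact hD.lintegral_comp_lt_top n ih

lemma integrable_semigroup (hD : DriftCondition F V δ d₀ b) {p n : ℕ} (h : p ≤ n) (x : X) :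
    Integrable (expWeight V) (F.semigroup p n x) :=
  lintegral_ofReal_ne_top_iff_integrable hD.measurable_expWeight.aestronglyMeasurable
    (.of_forall fun _ => (expWeight_pos V _).le) |>.1 (hD.lintegral_semigroup_lt_top h x).ne

lemma integrable_gamma (hD : DriftCondition F V δ d₀ b) {μ : Measure X}
    (hμ : MemPv (expWeight V) μ) (n : ℕ) : Integrable (expWeight V) (F.gamma μ n) :=
  lintegral_ofReal_ne_top_iff_integrable hD.measurable_expWeight.aestronglyMeasurable
    (.of_forall fun _ => (expWeight_pos V _).le) |>.1 (hD.lintegral_gamma_lt_top hμ n).ne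

lemma _root_.integrable_of_abs_le_mul {η : Measure X}
    (hη : Integrable (expWeight V) η) {φ : X → ℝ} (hφ : AEStronglyMeasurable φ η) {c : ℝ}
    (h : ∀ x, |φ x| ≤ c * expWeight V x) : Integrable φ η :=
  (hη.const_mul c).mono' hφ (.of_forall h)

lemma isFiniteMeasure_of_integrable (hD : DriftCondition F V δ d₀ b) {η : Measure X}
    (hη : Integrable (expWeight V) η) : IsFiniteMeasure η := by
  have : Integrable (fun _ : X => (1 : ℝ)) η :=
    integrable_of_abs_le_mul (c := 1) hη aestronglyMeasurable_const
      fun x => by simpa using hD.one_le_expWeight x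
  simpa [integrable_const_iff] using this

end DriftCondition

end Drift

lemma abs_le_vNorm_mul {X : Type*} [MeasurableSpace X] {v φ : X → ℝ} (hv : ∀ x, 0 < v x)
    (hφ : MemLv v φ) (x : X) : |φ x| ≤ vNorm v φ * v x := by
  rw [← div_le_iff₀ (hv x)]
  exact le_ciSup hφ.2 x

lemma vNorm_nonneg {X : Type*} {v : X → ℝ} (hv : ∀ x, 0 < v x) (φ : X → ℝ) : 0 ≤ vNorm v φ :=
  Real.iSup_nonneg fun x => div_nonneg (abs_nonneg _) (hv x).le

lemma sublevel_mono {X : Type*} (V : X → ℝ) {r d : ℝ} (h : r ≤ d) : sublevel V r ⊆ sublevel V d :=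
  fun _ hx => le_trans hx h

/-! ### Uniform estimates for the unnormalised flow and for the total masses. -/

section Bounds

variable {X : Type*} [MeasurableSpace X] {F : FKModel X} {V : X → ℝ} {δ d₀ : ℝ}
  {b εm εp : ℝ → ℝ} {ν : ℝ → Measure X} {μ : Measure X}

/-- The lower bound `ε_d ν_d(C_r)` on the mass that each kernel sends from `C_d` to `C_r`. -/
noncomputable def returnMass (V : X → ℝ) (εm : ℝ → ℝ) (ν : ℝ → Measure X) (r d : ℝ) : ℝ :=
  εm d * (ν d).real (sublevel V r)

namespace MinorizationCondition

lemma returnMass_pos (hm : MinorizationCondition F V d₀ εm ν) {r d : ℝ} (hr : d₀ ≤ r)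
    (hd : r ≤ d) : 0 < returnMass V εm ν r d := by
  have := (hm.nu_mem d (hr.trans hd)).1
  exact mul_pos (hm.eps_pos d (hr.trans hd))
    (ENNReal.toReal_pos (hm.nu_pos d (hr.trans hd) r ⟨hr, hd⟩).ne' (measure_ne_top _ _))

lemma smul_restrict_le (hm : MinorizationCondition F V d₀ εm ν) {d : ℝ}
    (hd : d₀ ≤ d) (n : ℕ) {x : X} (hx : x ∈ sublevel V d) :
    ENNReal.ofReal (εm d) • (ν d).restrict (sublevel V d) ≤ F.Q (n + 1) x := by
  refine Measure.le_iff.2 fun A hA => ?_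
  rw [Measure.smul_apply, smul_eq_mul, Measure.restrict_apply hA, Set.inter_comm]
  exact (hm.minor d hd (n + 1) (by lia) x hx A hA).trans (measure_mono Set.inter_subset_right)

lemma setIntegral_le (hm : MinorizationCondition F V d₀ εm ν) {d : ℝ}
    (hd : d₀ ≤ d) (n : ℕ) {x : X} (hx : x ∈ sublevel V d) {g : X → ℝ} (hg : ∀ y, 0 ≤ g y)
    (hgi : Integrable g (F.Q (n + 1) x)) :
    εm d * ∫ y in sublevel V d, g y ∂(ν d) ≤ ∫ y, g y ∂(F.Q (n + 1) x) := by
  have := integral_mono_measure (hm.smul_restrict_le hd n hx) (.of_forall hg) hgi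
  rwa [integral_smul_measure, ENNReal.toReal_ofReal (hm.eps_pos d hd).le] at this

lemma returnMass_le (hm : MinorizationCondition F V d₀ εm ν) (hV : Measurable V) {r d : ℝ}
    (hr : d₀ ≤ r) (hd : r ≤ d) (n : ℕ) {x : X} (hx : x ∈ sublevel V d) :
    returnMass V εm ν r d ≤ (F.Q (n + 1) x).real (sublevel V r) := by
  have h := hm.minor d (hr.trans hd) (n + 1) (by lia) x hx _ (measurableSet_sublevel hV r)
  rw [Set.inter_eq_self_of_subset_right (sublevel_mono V hd)] at h
  have h2 := ENNReal.toReal_mono (measure_ne_top _ _) h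
  rwa [ENNReal.toReal_mul, ENNReal.toReal_ofReal (hm.eps_pos d (hr.trans hd)).le] at h2

lemma returnMass_mul_le_integral (hm : MinorizationCondition F V d₀ εm ν) (hV : Measurable V)
    {r d : ℝ} (hr : d₀ ≤ r) (hd : r ≤ d) (n : ℕ) {x : X} (hx : x ∈ sublevel V d) {g : X → ℝ}
    (hg : ∀ y, 0 ≤ g y) (hgi : Integrable g (F.Q (n + 1) x)) {c : ℝ} (hc : 0 ≤ c)
    (hcg : ∀ y ∈ sublevel V r, c ≤ g y) :
    returnMass V εm ν r d * c ≤ ∫ y, g y ∂(F.Q (n + 1) x) :=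
  calc returnMass V εm ν r d * c ≤ (F.Q (n + 1) x).real (sublevel V r) * c := by
        gcongr; exact hm.returnMass_le hV hr hd n hx
    _ = ∫ _ in sublevel V r, c ∂(F.Q (n + 1) x) := by rw [setIntegral_const, smul_eq_mul]
    _ ≤ ∫ y in sublevel V r, g y ∂(F.Q (n + 1) x) :=
        setIntegral_mono_on (integrable_const _).integrableOn hgi.integrableOn
          (measurableSet_sublevel hV r) hcg
    _ ≤ ∫ y, g y ∂(F.Q (n + 1) x) := setIntegral_le_integral hgi (.of_forall hg)

end MinorizationCondition

lemma MajorizationCondition.setIntegral_le (hM : MajorizationCondition F V d₀ εm ν εp)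
    {d : ℝ} (hd : d₀ ≤ d) (hε : 0 ≤ εp d) (n : ℕ) {x : X}
    (hx : x ∈ sublevel V d) {g : X → ℝ} (hg : ∀ y, 0 ≤ g y) (hgi : Integrable g (ν d)) :
    ∫ y in sublevel V d, g y ∂(F.Q (n + 1) x) ≤ εp d * ∫ y in sublevel V d, g y ∂(ν d) := by
  have hle : (F.Q (n + 1) x).restrict (sublevel V d) ≤
      ENNReal.ofReal (εp d) • (ν d).restrict (sublevel V d) := by
    refine Measure.le_iff.2 fun A hA => ?_
    rw [Measure.smul_apply, smul_eq_mul, Measure.restrict_apply hA, Measure.restrict_apply hA,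
      Set.inter_comm]
    exact hM.major d hd (n + 1) (by lia) x hx A hA
  have := integral_mono_measure hle (.of_forall hg)
    (hgi.restrict.smul_measure ENNReal.ofReal_ne_top)
  rwa [integral_smul_measure, ENNReal.toReal_ofReal hε] at this

/-- The minorization integrated against `γ_n`: mass in a large sublevel set yields a fixed share of
mass in `C_r` one step later. -/
lemma returnMass_mul_real_gamma_le (hD : DriftCondition F V δ d₀ b)
    (hμ : MemPv (expWeight V) μ) (hm : MinorizationCondition F V d₀ εm ν) {r d : ℝ}
    (hr : d₀ ≤ r) (hd : r ≤ d) (n : ℕ) :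
    returnMass V εm ν r d * (F.gamma μ n).real (sublevel V d) ≤
      (F.gamma μ (n + 1)).real (sublevel V r) := by
  have hV := hD.measurable_V
  have := hD.isFiniteMeasure_of_integrable (hD.integrable_gamma hμ n)
  have := hD.isFiniteMeasure_of_integrable (hD.integrable_gamma hμ (n + 1))
  have hi : Integrable ((sublevel V r).indicator (fun _ => (1 : ℝ))) (F.gamma μ (n + 1)) :=
    (integrable_const _).indicator (measurableSet_sublevel hV r)
  have hi2 : Integrable ((sublevel V d).indicator (fun _ => returnMass V εm ν r d))
      (F.gamma μ n) := (integrable_const _).indicator (measurableSet_sublevel hV d)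
  rw [F.gamma_succ, Measure.comp_eq_comp_const_apply] at hi
  have heq : (F.gamma μ (n + 1)).real (sublevel V r) =
      ∫ x, (F.Q (n + 1) x).real (sublevel V r) ∂(F.gamma μ n) := by
    rw [← integral_indicator_one (measurableSet_sublevel hV r), F.gamma_succ,
      Measure.comp_eq_comp_const_apply]
    refine (Kernel.integral_comp hi).trans ?_
    rw [Kernel.const_apply]
    refine integral_congr_ae (.of_forall fun x => ?_)
    exact integral_indicator_one (measurableSet_sublevel hV r)
  have hi3 : Integrable (fun x => (F.Q (n + 1) x).real (sublevel V r)) (F.gamma μ n) := by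
    have h := hi.integral_comp
    rw [Kernel.const_apply] at h
    refine h.congr (.of_forall fun x => ?_)
    exact integral_indicator_one (measurableSet_sublevel hV r)
  rw [heq]
  calc returnMass V εm ν r d * (F.gamma μ n).real (sublevel V d)
      = ∫ x, (sublevel V d).indicator (fun _ => returnMass V εm ν r d) x
          ∂(F.gamma μ n) := by
        rw [integral_indicator_const _ (measurableSet_sublevel hV d), smul_eq_mul, mul_comm]
    _ ≤ _ := by
        refine integral_mono hi2 hi3 fun x => ?_
        by_cases hx : x ∈ sublevel V d
        · simpa [hx] using hm.returnMass_le hV hr hd n hx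
        · simp [hx]

/-- The unnormalised flow keeps a fixed proportion of its `v`-mass in a sublevel set. -/
lemma integral_gamma_le_mul_real (hD : DriftCondition F V δ d₀ b) (hμ : MemPv (expWeight V) μ)
    (hm : MinorizationCondition F V d₀ εm ν) {r d : ℝ} (hr : d₀ ≤ r) (hd : r ≤ d)
    (hκ : Real.exp (-(δ * d)) ≤ returnMass V εm ν r r / 2) {B : ℝ} (hB0 : 0 ≤ B)
    (hB : 2 * (Real.exp |b d| * Real.exp d) ≤ B * returnMass V εm ν r d)
    (hinit : ∫ y, expWeight V y ∂μ ≤ B * μ.real (sublevel V r))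
    (hpos : 0 < μ.real (sublevel V r)) (n : ℕ) :
    ∫ y, expWeight V y ∂(F.gamma μ n) ≤ B * (F.gamma μ n).real (sublevel V r) ∧
      0 < (F.gamma μ n).real (sublevel V r) := by
  have hV := hD.measurable_V
  have hdd := hr.trans hd
  induction n with
  | zero => rw [F.gamma_zero]; exact ⟨hinit, hpos⟩
  | succ n ih =>
    have hint := hD.integrable_gamma hμ n
    have hint1 := hD.integrable_gamma hμ (n + 1)
    have := hD.isFiniteMeasure_of_integrable hint
    have := hD.isFiniteMeasure_of_integrable hint1
    have hθ := hm.returnMass_pos hr le_rfl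
    have hdrift : ∫ y, expWeight V y ∂(F.gamma μ (n + 1)) ≤
        Real.exp (-(δ * d)) * ∫ y, expWeight V y ∂(F.gamma μ n) +
          Real.exp |b d| * Real.exp d * (F.gamma μ n).real (sublevel V d) := by
      have hi := hint1
      rw [F.gamma_succ, Measure.comp_eq_comp_const_apply] at hi ⊢
      have hi' := hi.integral_comp
      rw [Kernel.integral_comp hi]
      rw [Kernel.const_apply] at hi' ⊢
      have hi2 : Integrable ((sublevel V d).indicator
          (fun _ => Real.exp |b d| * Real.exp d)) (F.gamma μ n) :=
        (integrable_const _).indicator (measurableSet_sublevel hV d)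
      rw [← integral_const_mul, mul_comm (Real.exp |b d| * Real.exp d), ← smul_eq_mul
        ((F.gamma μ n).real _), ← integral_indicator_const _ (measurableSet_sublevel hV d),
        ← integral_add (hint.const_mul _) hi2]
      refine integral_mono hi' ((hint.const_mul _).add hi2) fun x => ?_
      by_cases hx : x ∈ sublevel V d
      · simp only [hx, Set.indicator_of_mem]
        have h1 := hD.integral_Q_le hdd n x
        have h2 : expWeight V x ≤ Real.exp d := Real.exp_le_exp.2 hx
        have h3 := mul_pos (Real.exp_pos (-(δ * d))) (expWeight_pos V x)
        nlinarith [Real.exp_pos |b d|]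
      · simpa [hx] using hD.integral_Q_le_of_notMem hdd n hx
    have h1 := returnMass_mul_real_gamma_le hD hμ hm hr le_rfl n
    have h2 := returnMass_mul_real_gamma_le hD hμ hm hr hd n
    refine ⟨?_, (mul_pos hθ ih.2).trans_le h1⟩
    -- Each of the two drift terms is at most `(B/2) γ_{n+1}(C_r)`: the contracted one through
    -- return from `C_r` to `C_r`, the one on `C_d` through return from `C_d` to `C_r`.
    have h3 : Real.exp (-(δ * d)) * ∫ y, expWeight V y ∂(F.gamma μ n) ≤
        returnMass V εm ν r r / 2 * (B * (F.gamma μ n).real (sublevel V r)) :=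
      mul_le_mul hκ ih.1 (integral_nonneg fun _ => (expWeight_pos V _).le) (by positivity)
    have h4 := mul_le_mul_of_nonneg_right hB
      (measureReal_nonneg (μ := F.gamma μ n) (s := sublevel V d))
    have h5 := mul_le_mul_of_nonneg_left h1 hB0
    have h6 := mul_le_mul_of_nonneg_left h2 hB0
    linarith

lemma semigroupOp_one_nonneg (F : FKModel X) (p n : ℕ) (x : X) :
    0 ≤ F.semigroupOp p n (fun _ => 1) x := integral_nonneg fun _ => zero_le_one

lemma DriftCondition.integrable_one (hD : DriftCondition F V δ d₀ b) {η : Measure X}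
    (hη : Integrable (expWeight V) η) : Integrable (fun _ : X => (1 : ℝ)) η :=
  have := hD.isFiniteMeasure_of_integrable hη
  integrable_const _

lemma measurable_semigroupOp (F : FKModel X) (p n : ℕ) {φ : X → ℝ} (hφ : Measurable φ) :
    Measurable (F.semigroupOp p n φ) :=
  (hφ.stronglyMeasurable.integral_kernel (κ := F.semigroup p n)).measurable

/-- The total masses `Q_{p,n}(1)` are bounded by `v` times their infimum on a sublevel set. -/
lemma exists_semigroupOp_one_bounds (hD : DriftCondition F V δ d₀ b)
    (hm : MinorizationCondition F V d₀ εm ν) (hM : MajorizationCondition F V d₀ εm ν εp)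
    {r d : ℝ} (hr : d₀ ≤ r) (hd : r ≤ d) {k A : ℝ} (hk0 : 0 < k) (hk1 : k ≤ 1)
    (hk : Real.exp (-(δ * d)) ≤ k * returnMass V εm ν r r)
    (hkE : 2 * (k * Real.exp |b d₀|) ≤ returnMass V εm ν r r)
    (hA : 1 ≤ k * A) (hAε : 2 * εp d ≤ A * εm d) {p n : ℕ} (hpn : p ≤ n) :
    ∃ j : ℝ, 0 < j ∧ (∀ x ∈ sublevel V r, j ≤ F.semigroupOp p n (fun _ => 1) x) ∧
      (∀ x, F.semigroupOp p n (fun _ => 1) x ≤ A * j * expWeight V x) ∧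
      ∀ x ∉ sublevel V d, F.semigroupOp p n (fun _ => 1) x ≤ k * (A * j) * expWeight V x := by
  have hV := hD.measurable_V
  have hdd := hr.trans hd
  have hA0 : 0 < A := by by_contra! h; nlinarith
  have hθ := hm.returnMass_pos hr le_rfl
  induction hpn using Nat.decreasingInduction with
  | self =>
    simp_rw [F.semigroupOp_self n measurable_const]
    have hv := hD.one_le_expWeight
    refine ⟨1, one_pos, fun _ _ => le_rfl, fun x => ?_, fun x _ => ?_⟩
    · nlinarith [hv x]
    · nlinarith [hv x]
  | of_succ p hpn ih =>
    obtain ⟨j, hj, hlow, hup, hout⟩ := ih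
    have hrec : ∀ x, F.semigroupOp p n (fun _ => 1) x =
        ∫ y, F.semigroupOp (p + 1) n (fun _ => 1) y ∂(F.Q (p + 1) x) := fun x =>
      F.semigroupOp_succ_left hpn (hD.integrable_one (hD.integrable_semigroup hpn.le x))
    set H := F.semigroupOp (p + 1) n (fun _ => 1) with hH
    have hH0 : ∀ y, 0 ≤ H y := semigroupOp_one_nonneg F _ _
    have hHm : Measurable H := measurable_semigroupOp F _ _ measurable_const
    have hHi : ∀ η : Measure X, Integrable (expWeight V) η → Integrable H η := fun η hη =>
      integrable_of_abs_le_mul hη hHm.aestronglyMeasurable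
        fun y => by rw [abs_of_nonneg (hH0 y)]; exact hup y
    have hν : Integrable (expWeight V) (ν d) :=
      lintegral_ofReal_ne_top_iff_integrable hD.measurable_expWeight.aestronglyMeasurable
        (.of_forall fun _ => (expWeight_pos V _).le) |>.1 (hm.nu_mem d hdd).2.ne
    have hεm := hm.eps_pos d hdd
    set i := ∫ y in sublevel V d, H y ∂(ν d) with hi
    have hi0 : 0 ≤ i := integral_nonneg hH0
    -- Both entries bound `Q_{p,n}(1)` from below on `C_r`. The first controls the contribution from
    -- outside `C_d`, the second, through the majorization, that from inside; no comparison between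
    -- them is needed.
    set j' := max (returnMass V εm ν r r * j) (εm d * i) with hj'
    have hj1 : returnMass V εm ν r r * j ≤ j' := le_max_left _ _
    have hj2 : εm d * i ≤ j' := le_max_right _ _
    have hj'0 : 0 < j' := (mul_pos hθ hj).trans_le hj1
    have hout' : ∀ x ∉ sublevel V d, F.semigroupOp p n (fun _ => 1) x ≤
        k * (A * j') * expWeight V x := by
      intro x hx
      rw [hrec x]
      calc ∫ y, H y ∂(F.Q (p + 1) x) ≤ ∫ y, A * j * expWeight V y ∂(F.Q (p + 1) x) :=
            integral_mono (hHi _ (hD.integrable_Q p x)) ((hD.integrable_Q p x).const_mul _) hup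
        _ = A * j * ∫ y, expWeight V y ∂(F.Q (p + 1) x) := integral_const_mul _ _
        _ ≤ A * j * (k * returnMass V εm ν r r * expWeight V x) := by
            gcongr
            refine (hD.integral_Q_le_of_notMem hdd p hx).trans ?_
            gcongr
            exact (expWeight_pos V x).le
        _ = k * (A * (returnMass V εm ν r r * j)) * expWeight V x := by ring
        _ ≤ _ := by
            have := expWeight_pos V x
            gcongr
    refine ⟨j', hj'0, fun x hx => ?_, fun x => ?_, hout'⟩
    · rw [hrec x]
      refine max_le ?_ ?_
      · exact hm.returnMass_mul_le_integral hV hr le_rfl p hx hH0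
          (hHi _ (hD.integrable_Q p x)) hj.le hlow
      · exact hm.setIntegral_le hdd p (sublevel_mono V hd hx) hH0 (hHi _ (hD.integrable_Q p x))
    · have hv0 := expWeight_pos V x
      by_cases hx : x ∈ sublevel V d
      · rw [hrec x]
        have hQi := hHi _ (hD.integrable_Q p x)
        rw [← integral_add_compl (measurableSet_sublevel hV d) hQi]
        have h1 := hM.setIntegral_le hdd (hεm.le.trans (hM.eps_le d hdd)) p hx hH0 (hHi _ hν)
        -- The extra factor `k` in the bound off `C_d` is carried through the induction for this
        -- term: it offsets `e^{|b d₀|}`, leaving half of `A j' v`. The integral over `C_d` takes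
        -- the other half.
        have h2 : ∫ y in (sublevel V d)ᶜ, H y ∂(F.Q (p + 1) x) ≤
            k * (A * j) * (Real.exp |b d₀| * expWeight V x) :=
          calc ∫ y in (sublevel V d)ᶜ, H y ∂(F.Q (p + 1) x)
              ≤ ∫ y in (sublevel V d)ᶜ, k * (A * j) * expWeight V y ∂(F.Q (p + 1) x) :=
                setIntegral_mono_on hQi.integrableOn
                  ((hD.integrable_Q p x).const_mul _).integrableOn
                  (measurableSet_sublevel hV d).compl hout
            _ ≤ ∫ y, k * (A * j) * expWeight V y ∂(F.Q (p + 1) x) :=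
                setIntegral_le_integral ((hD.integrable_Q p x).const_mul _)
                  (.of_forall fun y => mul_nonneg (by positivity) (expWeight_pos V y).le)
            _ = k * (A * j) * ∫ y, expWeight V y ∂(F.Q (p + 1) x) := integral_const_mul _ _
            _ ≤ _ := by gcongr; exact hD.integral_Q_le le_rfl p x
        have h3 : εp d * i ≤ A / 2 * j' := by
          nlinarith [mul_le_mul_of_nonneg_right hAε hi0, mul_le_mul_of_nonneg_left hj2 hA0.le]
        have h4 : k * (A * j) * (Real.exp |b d₀| * expWeight V x) ≤
            A / 2 * j' * expWeight V x := by
          have h5 := mul_le_mul_of_nonneg_right hkE hj.le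
          have h6 := mul_le_mul_of_nonneg_left (h5.trans hj1)
            (mul_pos (half_pos hA0) hv0).le
          linarith
        have h7 : A / 2 * j' ≤ A / 2 * j' * expWeight V x :=
          le_mul_of_one_le_right (by positivity) (hD.one_le_expWeight x)
        linarith
      · refine (hout' x hx).trans ?_
        have : 0 < A * j' * expWeight V x := by positivity
        nlinarith

end Bounds

/-! ### Weighted contraction relative to a positive function. -/

/-- If `u` and `w` satisfy `u x * w y - u y * w x ≤ a x * w y + a y * w x`, then `u` is within `a`
of a multiple of `w`. -/
lemma exists_abs_sub_mul_le {X : Type*} {u w a : X → ℝ} (hw : ∀ x, 0 < w x)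
    (h : ∀ x y, u x * w y - u y * w x ≤ a x * w y + a y * w x) :
    ∃ c : ℝ, ∀ x, |u x - c * w x| ≤ a x := by
  rcases isEmpty_or_nonempty X with hX | ⟨⟨x₀⟩⟩
  · exact ⟨0, fun x => hX.elim x⟩
  have hle : ∀ x y, (u x - a x) / w x ≤ (u y + a y) / w y := fun x y => by
    rw [div_le_div_iff₀ (hw x) (hw y)]
    linarith [h x y]
  have hbdd : BddAbove (Set.range fun x => (u x - a x) / w x) :=
    ⟨_, Set.forall_mem_range.2 fun x => hle x x₀⟩
  have : Nonempty X := ⟨x₀⟩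
  -- The intervals `[(u - a)/w, (u + a)/w]` meet pairwise, so the supremum of the left endpoints
  -- lies in all of them.
  refine ⟨⨆ x, (u x - a x) / w x, fun x => abs_le.2 ⟨?_, ?_⟩⟩
  · have := (le_div_iff₀ (hw x)).1 (ciSup_le fun y => hle y x)
    linarith
  · have := (div_le_iff₀ (hw x)).1 (le_ciSup hbdd x)
    linarith

/-- One-step contraction of a weighted oscillation seminorm relative to a positive function `h`,
for a family of measures with a drift and a local minorization. -/
lemma exists_abs_sub_mul_le_of_drift_of_minorization {X : Type*} [MeasurableSpace X]
    {q : X → Measure X} {v f h f' h' : X → ℝ} {lam K s α β A c : ℝ} {ν₀ : Measure X}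
    (hv : ∀ x, 0 < v x) (hvi : ∀ x, Integrable v (q x)) (hhi : ∀ x, Integrable h (q x))
    (hfi : ∀ x, Integrable f (q x)) (hlam : 0 < lam)
    (hh' : ∀ x, lam * h' x = ∫ y, h y ∂(q x)) (hf' : ∀ x, lam * f' x = ∫ y, f y ∂(q x))
    (hpos : ∀ x, 0 < h' x)
    (hdrift : ∀ x, ∫ y, v y ∂(q x) ≤ lam * (v x / 2 + K * h' x))
    (hmin : ∀ x, v x < 16 * K * h' x → ν₀ ≤ q x ∧ s * h' x * lam ≤ ∫ y, h y ∂ν₀)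
    (hβ : 0 ≤ β) (hβK : β * K = s / 2) (hα : 3 / 4 ≤ α) (hαs : 1 - s / 2 ≤ α) (hA : 0 ≤ A)
    (hf : ∀ x, |f x - c * h x| ≤ A * (h x + β * v x)) :
    ∃ c' : ℝ, ∀ x, |f' x - c' * h' x| ≤ α * A * (h' x + β * v x) := by
  suffices H : ∀ x y, (f' x - c * h' x) * h' y - (f' y - c * h' y) * h' x ≤
      α * A * (h' x + β * v x) * h' y + α * A * (h' y + β * v y) * h' x by
    refine exists_abs_sub_mul_le hpos fun x y => ?_
    linarith [H x y]
  have hui : ∀ {η : Measure X}, Integrable f η → Integrable h η →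
      Integrable (fun y => f y - c * h y) η := fun h1 h2 => h1.sub (h2.const_mul c)
  have hgi : ∀ {η : Measure X}, Integrable h η → Integrable v η →
      Integrable (fun y => A * (h y + β * v y)) η := fun h1 h2 =>
    (h1.add (h2.const_mul β)).const_mul A
  have hU : ∀ x, ∫ y, (f y - c * h y) ∂(q x) = lam * (f' x - c * h' x) := fun x => by
    rw [integral_sub (hfi x) ((hhi x).const_mul c), integral_const_mul, ← hf', ← hh']; ring
  have hG : ∀ x, ∫ y, A * (h y + β * v y) ∂(q x) =
      A * (lam * h' x + β * ∫ y, v y ∂(q x)) := fun x => by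
    rw [integral_const_mul, integral_add (hhi x) ((hvi x).const_mul β), integral_const_mul,
      ← hh']
  have hGle : ∀ x, ∫ y, A * (h y + β * v y) ∂(q x) ≤
      lam * (A * (h' x + β * (v x / 2 + K * h' x))) := fun x => by
    rw [hG]
    have := mul_le_mul_of_nonneg_left (hdrift x) (mul_nonneg hA hβ)
    linarith
  have hsub : ∀ x, 0 ≤ A * (h x + β * v x) - (f x - c * h x) := fun x => by
    linarith [(abs_le.1 (hf x)).2]
  have hadd : ∀ x, 0 ≤ A * (h x + β * v x) + (f x - c * h x) := fun x => by
    linarith [(abs_le.1 (hf x)).1]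
  have hup : ∀ x, f' x - c * h' x ≤ A * (h' x + β * (v x / 2 + K * h' x)) := fun x => by
    have h1 : 0 ≤ ∫ y, (A * (h y + β * v y) - (f y - c * h y)) ∂(q x) := integral_nonneg hsub
    rw [integral_sub (hgi (hhi x) (hvi x)) (hui (hfi x) (hhi x)), hU] at h1
    exact le_of_mul_le_mul_left (by linarith [hGle x]) hlam
  have hlow : ∀ x, -(f' x - c * h' x) ≤ A * (h' x + β * (v x / 2 + K * h' x)) := fun x => by
    have h1 : 0 ≤ ∫ y, (A * (h y + β * v y) + (f y - c * h y)) ∂(q x) := integral_nonneg hadd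
    rw [integral_add (hgi (hhi x) (hvi x)) (hui (hfi x) (hhi x)), hU] at h1
    exact le_of_mul_le_mul_left (by linarith [hGle x]) hlam
  intro x y
  have hx := hpos x
  have hy := hpos y
  have hxy := mul_pos hx hy
  have hS : 0 < v x * h' y + v y * h' x := add_pos (mul_pos (hv x) hy) (mul_pos (hv y) hx)
  -- Far case: the halved `v` suffices. Since `2 - 2α ≤ s = 2βK`, the excess is at most `4βK
  -- h'(x)h'(y)`, hence at most a quarter of `β (v(x)h'(y) + v(y)h'(x))`, and `α - 1/2 ≥ 1/4`. Near
  -- case: both points lie in the minorization region.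
  rcases le_or_gt (16 * K * (h' x * h' y)) (v x * h' y + v y * h' x) with hfar | hnear
  · have h1 := mul_le_mul_of_nonneg_right (hup x) hy.le
    have h2 := mul_le_mul_of_nonneg_right (hlow y) hx.le
    have h3 : (2 + 2 * (β * K) - 2 * α) * (h' x * h' y) ≤
        (α - 1 / 2) * (β * (v x * h' y + v y * h' x)) := by
      have h4 := mul_le_mul_of_nonneg_left hfar hβ
      have h5 : 0 ≤ β * (v x * h' y + v y * h' x) := mul_nonneg hβ hS.le
      have h6 : (2 + 2 * (β * K) - 2 * α) * (h' x * h' y) ≤ 4 * (β * K) * (h' x * h' y) :=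
        mul_le_mul_of_nonneg_right (by linarith) hxy.le
      nlinarith
    have h7 := mul_le_mul_of_nonneg_left h3 hA
    linarith
  · have hnx : v x < 16 * K * h' x := by
      have := mul_pos (hv y) hx
      exact lt_of_mul_lt_mul_right (by linarith) hy.le
    have hny : v y < 16 * K * h' y := by
      have := mul_pos (hv x) hy
      exact lt_of_mul_lt_mul_right (by linarith) hx.le
    obtain ⟨hνx, hsx⟩ := hmin x hnx
    obtain ⟨hνy, hsy⟩ := hmin y hny
    have hνh := (hhi x).mono_measure hνx
    have hνv := (hvi x).mono_measure hνx
    have hνf := (hfi x).mono_measure hνx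
    have h1 := integral_mono_measure hνx (.of_forall hsub)
      ((hgi (hhi x) (hvi x)).sub (hui (hfi x) (hhi x)))
    have h2 := integral_mono_measure hνy (.of_forall hadd)
      ((hgi (hhi y) (hvi y)).add (hui (hfi y) (hhi y)))
    have ha : 0 ≤ ∫ y, (A * (h y + β * v y) - (f y - c * h y)) ∂ν₀ := integral_nonneg hsub
    have hb : 0 ≤ ∫ y, (A * (h y + β * v y) + (f y - c * h y)) ∂ν₀ := integral_nonneg hadd
    -- The two nonnegative slacks `A(h + βv) ∓ (f - c h)` add up to `2A(h + βv)`, so they cannot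
    -- both be small under the common component `ν₀`.
    have hab : 2 * A * ∫ y, h y ∂ν₀ ≤ (∫ y, (A * (h y + β * v y) - (f y - c * h y)) ∂ν₀) +
        ∫ y, (A * (h y + β * v y) + (f y - c * h y)) ∂ν₀ := by
      rw [integral_sub (hgi hνh hνv) (hui hνf hνh), integral_add (hgi hνh hνv) (hui hνf hνh),
        integral_const_mul, integral_add hνh (hνv.const_mul β), integral_const_mul]
      have : 0 ≤ A * (β * ∫ y, v y ∂ν₀) :=
        mul_nonneg hA (mul_nonneg hβ (integral_nonneg fun y => (hv y).le))
      linarith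
    rw [integral_sub (hgi (hhi x) (hvi x)) (hui (hfi x) (hhi x)), hU] at h1
    rw [integral_add (hgi (hhi y) (hvi y)) (hui (hfi y) (hhi y)), hU] at h2
    have h1' := h1.trans (sub_le_sub_right (hGle x) _)
    have h2' := h2.trans (add_le_add_left (hGle y) _)
    generalize (∫ y, (A * (h y + β * v y) - (f y - c * h y)) ∂ν₀) = a at ha hab h1'
    generalize (∫ y, (A * (h y + β * v y) + (f y - c * h y)) ∂ν₀) = b at hb hab h2'
    -- Bound both weights below by the smaller of `h'(x)`, `h'(y)` and use the minorization at the
    -- point with the larger. The gain `2As` exceeds the drift cost `2AβK = As` by `As`, whence `α ≥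
    -- 1 - s/2`.
    have hmain : 2 * A * s * (h' x * h' y) * lam ≤ a * h' y + b * h' x := by
      rcases le_total (h' x) (h' y) with hle | hle
      · have h3 := mul_le_mul_of_nonneg_left hsy (mul_nonneg hA hx.le)
        have h4 := mul_le_mul_of_nonneg_right hab hx.le
        have h5 := mul_le_mul_of_nonneg_left hle ha
        linarith
      · have h3 := mul_le_mul_of_nonneg_left hsx (mul_nonneg hA hy.le)
        have h4 := mul_le_mul_of_nonneg_right hab hy.le
        have h5 := mul_le_mul_of_nonneg_left hle hb
        linarith
    have h6 := mul_le_mul_of_nonneg_right h1' hy.le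
    have h7 := mul_le_mul_of_nonneg_right h2' hx.le
    have h8 : 0 ≤ (2 * α - 2 + s) * (A * (h' x * h' y)) :=
      mul_nonneg (by linarith) (mul_nonneg hA hxy.le)
    have h9 : 0 ≤ (α - 1 / 2) * (A * (β * (v x * h' y + v y * h' x))) :=
      mul_nonneg (by linarith) (mul_nonneg hA (mul_nonneg hβ hS.le))
    refine le_of_mul_le_mul_left ?_ hlam
    have h10 := mul_nonneg hlam.le h8
    have h11 := mul_nonneg hlam.le h9
    have h12 : lam * (A * (β * K * (h' x * h' y))) = lam * (A * (s / 2 * (h' x * h' y))) := by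
      rw [hβK]
    linarith

/-! ### The normalised semigroup and its contraction. -/

section Normalised

variable {X : Type*} [MeasurableSpace X] {F : FKModel X} {V : X → ℝ} {δ d₀ : ℝ}
  {b εm εp : ℝ → ℝ} {ν : ℝ → Measure X} {μ : Measure X}

lemma integral_eta (F : FKModel X) (μ : Measure X) (n : ℕ) (φ : X → ℝ) :
    ∫ y, φ y ∂(F.eta μ n) = (∫ y, φ y ∂(F.gamma μ n)) / (F.gamma μ n).real Set.univ := by
  rw [FKModel.eta, integral_smul_measure, ENNReal.toReal_inv, smul_eq_mul, measureReal_def]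
  ring

lemma integrable_eta {n : ℕ} (hpos : 0 < (F.gamma μ n).real Set.univ) {φ : X → ℝ}
    (hφ : Integrable φ (F.gamma μ n)) : Integrable φ (F.eta μ n) :=
  hφ.smul_measure (ENNReal.inv_ne_top.2 fun h => by simp [measureReal_def, h] at hpos)

/-- The normalised semigroup `Q_{p,n}(φ) / ∏_{q=p}^{n-1} λ_q`. -/
noncomputable def normOp (F : FKModel X) (μ : Measure X) (p n : ℕ) (φ : X → ℝ) (x : X) : ℝ :=
  F.semigroupOp p n φ x / ∏ q ∈ Finset.Ico p n, F.lam μ q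

lemma normOp_self (n : ℕ) {φ : X → ℝ} (hφ : Measurable φ) (x : X) :
    normOp F μ n n φ x = φ x := by
  simp [normOp, F.semigroupOp_self n hφ]

lemma integrable_normOp_Q {p n : ℕ} (h : p < n) {φ : X → ℝ} {x : X}
    (hφ : Integrable φ (F.semigroup p n x)) :
    Integrable (normOp F μ (p + 1) n φ) (F.Q (p + 1) x) :=
  (F.integrable_semigroupOp_Q h hφ).div_const _

lemma lam_mul_normOp {p n : ℕ} (h : p < n) (hlam : F.lam μ p ≠ 0) {φ : X → ℝ} {x : X}
    (hφ : Integrable φ (F.semigroup p n x)) :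
    F.lam μ p * normOp F μ p n φ x = ∫ y, normOp F μ (p + 1) n φ y ∂(F.Q (p + 1) x) := by
  simp only [normOp]
  rw [integral_div, ← F.semigroupOp_succ_left h hφ, Finset.prod_eq_prod_Ico_succ_bot h]
  field_simp

/-- As `M_{n+1}` is Markov, `Q_{n+1}(1) = G_n`. Thus `λ_n` is a ratio of successive masses and
products of the `λ_q` telescope. -/
lemma real_univ_gamma_succ (hD : DriftCondition F V δ d₀ b) (hμ : MemPv (expWeight V) μ) (n : ℕ) :
    Integrable (F.G n) (F.gamma μ n) ∧
      ∫ x, F.G n x ∂(F.gamma μ n) = (F.gamma μ (n + 1)).real Set.univ := by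
  have hi := hD.integrable_one (hD.integrable_gamma hμ (n + 1))
  have hG : F.semigroupOp n (n + 1) (fun _ => 1) = F.G n := by
    ext x
    rw [F.semigroupOp_succ_left n.lt_succ_self
      (hD.integrable_one (hD.integrable_semigroup n.le_succ x))]
    simp_rw [F.semigroupOp_self (n + 1) measurable_const]
    simp [F.Q_succ_real_univ]
  have h1 := F.integrable_semigroupOp_gamma μ n.le_succ hi
  have h2 := F.integral_gamma_eq μ n.le_succ hi
  rw [hG] at h1 h2
  refine ⟨h1, ?_⟩
  rw [← h2]
  simp

lemma lam_eq (hD : DriftCondition F V δ d₀ b) (hμ : MemPv (expWeight V) μ) (n : ℕ) :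
    F.lam μ n = (F.gamma μ (n + 1)).real Set.univ / (F.gamma μ n).real Set.univ := by
  rw [FKModel.lam, integral_eta, (real_univ_gamma_succ hD hμ n).2]

lemma prod_lam_eq (hD : DriftCondition F V δ d₀ b) (hμ : MemPv (expWeight V) μ)
    (hpos : ∀ n, 0 < (F.gamma μ n).real Set.univ) {p n : ℕ} (h : p ≤ n) :
    ∏ q ∈ Finset.Ico p n, F.lam μ q =
      (F.gamma μ n).real Set.univ / (F.gamma μ p).real Set.univ := by
  induction n, h using Nat.le_induction with
  | base => simp [(hpos p).ne']
  | succ n h ih =>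
    have := (hpos n).ne'
    rw [Finset.prod_Ico_succ_top h, ih, lam_eq hD hμ]
    field_simp

lemma integrable_normOp_gamma {p n : ℕ} (h : p ≤ n) {φ : X → ℝ}
    (hφ : Integrable φ (F.gamma μ n)) : Integrable (normOp F μ p n φ) (F.gamma μ p) :=
  (F.integrable_semigroupOp_gamma μ h hφ).div_const _

/-- The product of the `λ_q` is exactly the ratio of the normalisations of `γ_n = γ_p Q_{p,n}` and
`γ_p`. With `φ = 1` it gives `η_p(h_{p,n}) = 1`. -/
lemma integral_normOp_eta (hD : DriftCondition F V δ d₀ b) (hμ : MemPv (expWeight V) μ)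
    (hpos : ∀ n, 0 < (F.gamma μ n).real Set.univ) {p n : ℕ} (h : p ≤ n) {φ : X → ℝ}
    (hφ : Integrable φ (F.gamma μ n)) :
    ∫ y, normOp F μ p n φ y ∂(F.eta μ p) = ∫ y, φ y ∂(F.eta μ n) := by
  have h1 := (hpos n).ne'
  have h2 := (hpos p).ne'
  simp only [normOp]
  rw [integral_div, integral_eta, integral_eta, prod_lam_eq hD hμ hpos h,
    ← F.integral_gamma_eq μ h hφ]
  field_simp

lemma real_univ_gamma_le (hD : DriftCondition F V δ d₀ b) (hμ : MemPv (expWeight V) μ) (n : ℕ) :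
    (F.gamma μ n).real Set.univ ≤ ∫ y, expWeight V y ∂(F.gamma μ n) := by
  have hi := hD.integrable_gamma hμ n
  have := integral_mono (hD.integrable_one hi) hi hD.one_le_expWeight
  simpa using this

lemma le_lam (hD : DriftCondition F V δ d₀ b) (hμ : MemPv (expWeight V) μ)
    (hm : MinorizationCondition F V d₀ εm ν) {r B : ℝ} (hr : d₀ ≤ r) (hB : 0 < B)
    (hγ : ∀ n, ∫ y, expWeight V y ∂(F.gamma μ n) ≤ B * (F.gamma μ n).real (sublevel V r) ∧
      0 < (F.gamma μ n).real (sublevel V r)) (n : ℕ) :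
    returnMass V εm ν r r / B ≤ F.lam μ n := by
  have hfin : ∀ n, IsFiniteMeasure (F.gamma μ n) := fun n =>
    hD.isFiniteMeasure_of_integrable (hD.integrable_gamma hμ n)
  have hpos : 0 < (F.gamma μ n).real Set.univ :=
    (hγ n).2.trans_le (measureReal_mono (Set.subset_univ _))
  rw [lam_eq hD hμ, div_le_div_iff₀ hB hpos]
  have h1 := (real_univ_gamma_le hD hμ n).trans (hγ n).1
  have h2 := returnMass_mul_real_gamma_le hD hμ hm hr le_rfl n
  have h3 : (F.gamma μ (n + 1)).real (sublevel V r) ≤ (F.gamma μ (n + 1)).real Set.univ :=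
    measureReal_mono (Set.subset_univ _)
  have hθ := hm.returnMass_pos hr le_rfl
  nlinarith

/-- Uniform upper and lower bounds for `h_{p,n}`. -/
lemma normOp_one_bounds (hD : DriftCondition F V δ d₀ b) (hμ : MemPv (expWeight V) μ)
    {r A B j : ℝ} (hA : 0 < A) (hB : 0 < B) (hj : 0 < j)
    (hγ : ∀ n, ∫ y, expWeight V y ∂(F.gamma μ n) ≤ B * (F.gamma μ n).real (sublevel V r) ∧
      0 < (F.gamma μ n).real (sublevel V r)) {p n : ℕ} (hpn : p ≤ n)
    (hlow : ∀ x ∈ sublevel V r, j ≤ F.semigroupOp p n (fun _ => 1) x)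
    (hup : ∀ x, F.semigroupOp p n (fun _ => 1) x ≤ A * j * expWeight V x) :
    (∀ x ∈ sublevel V r, 1 / (A * B) ≤ normOp F μ p n (fun _ => 1) x) ∧
      ∀ x, normOp F μ p n (fun _ => 1) x ≤ A * B * expWeight V x := by
  have hV := hD.measurable_V
  have hfin : ∀ n, IsFiniteMeasure (F.gamma μ n) := fun n =>
    hD.isFiniteMeasure_of_integrable (hD.integrable_gamma hμ n)
  have hpos : ∀ n, 0 < (F.gamma μ n).real Set.univ := fun n =>
    (hγ n).2.trans_le (measureReal_mono (Set.subset_univ _))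
  have hp := hpos p
  have hn := hpos n
  have hone := hD.integrable_one (hD.integrable_gamma hμ n)
  have hHi := F.integrable_semigroupOp_gamma μ hpn hone
  have hg : (F.gamma μ n).real Set.univ =
      ∫ y, F.semigroupOp p n (fun _ => 1) y ∂(F.gamma μ p) := by
    rw [← F.integral_gamma_eq μ hpn hone]; simp
  -- `γ_n(1)` lies between `j γ_p(C_r)` and `A B j γ_p(C_r)`, so the unknown `j` cancels in
  -- `h_{p,n}`.
  have hgle : (F.gamma μ n).real Set.univ ≤ A * j * (B * (F.gamma μ p).real (sublevel V r)) := by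
    rw [hg]
    refine (integral_mono hHi ((hD.integrable_gamma hμ p).const_mul _) hup).trans ?_
    rw [integral_const_mul]
    exact mul_le_mul_of_nonneg_left (hγ p).1 (by positivity)
  have hgge : j * (F.gamma μ p).real (sublevel V r) ≤ (F.gamma μ n).real Set.univ := by
    rw [hg]
    calc j * (F.gamma μ p).real (sublevel V r) = ∫ _ in sublevel V r, j ∂(F.gamma μ p) := by
          rw [setIntegral_const, smul_eq_mul, mul_comm]
      _ ≤ ∫ y in sublevel V r, F.semigroupOp p n (fun _ => 1) y ∂(F.gamma μ p) :=
          setIntegral_mono_on (integrable_const _).integrableOn hHi.integrableOn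
            (measurableSet_sublevel hV r) hlow
      _ ≤ _ := setIntegral_le_integral hHi (.of_forall (semigroupOp_one_nonneg F p n))
  have hw : (F.gamma μ p).real (sublevel V r) ≤ (F.gamma μ p).real Set.univ :=
    measureReal_mono (Set.subset_univ _)
  have hgp : (F.gamma μ p).real Set.univ ≤ B * (F.gamma μ p).real (sublevel V r) :=
    (real_univ_gamma_le hD hμ p).trans (hγ p).1
  constructor
  · intro x hx
    rw [normOp, prod_lam_eq hD hμ hpos hpn, div_div_eq_mul_div, div_le_div_iff₀ (by positivity) hn]
    calc 1 * (F.gamma μ n).real Set.univ ≤ A * j * (B * (F.gamma μ p).real Set.univ) := by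
          rw [one_mul]; refine hgle.trans ?_; gcongr
      _ = j * (F.gamma μ p).real Set.univ * (A * B) := by ring
      _ ≤ _ := by gcongr; exact hlow x hx
  · intro x
    have hv := expWeight_pos V x
    rw [normOp, prod_lam_eq hD hμ hpos hpn, div_div_eq_mul_div, div_le_iff₀ hn]
    calc _ ≤ A * j * expWeight V x * (B * (F.gamma μ p).real (sublevel V r)) := by
          gcongr; exact hup x
      _ = A * B * expWeight V x * (j * (F.gamma μ p).real (sublevel V r)) := by ring
      _ ≤ _ := by gcongr

/-- Exponential contraction of the normalised semigroup, modulo multiples of `h_{p,n}`. -/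
lemma exists_abs_normOp_sub_le (hD : DriftCondition F V δ d₀ b)
    (hm : MinorizationCondition F V d₀ εm ν) {r d d' l D K s α β : ℝ} (hr : d₀ ≤ r)
    (hd : r ≤ d) (hd' : r ≤ d') (hl : 0 < l) (hlam : ∀ n, l ≤ F.lam μ n) (hDpos : 0 < D)
    {n : ℕ} (hlow : ∀ p ≤ n, ∀ x ∈ sublevel V r, 1 / D ≤ normOp F μ p n (fun _ => 1) x)
    (hup : ∀ p ≤ n, ∀ x, normOp F μ p n (fun _ => 1) x ≤ D * expWeight V x)
    (hκ : Real.exp (-(δ * d)) ≤ l / 2) (hK : 0 ≤ K)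
    (hKd : Real.exp |b d| * Real.exp d ≤ K * (returnMass V εm ν r d * (1 / D)))
    (hd'K : 16 * K * (D * Real.exp |b d₀|) ≤ l * Real.exp (δ * d')) (hs : 0 ≤ s)
    (hsd : s * (D * (Real.exp |b d₀| * Real.exp d')) ≤ returnMass V εm ν r d' * (1 / D))
    (hβ : 0 < β) (hβK : β * K = s / 2) (hα : 3 / 4 ≤ α) (hαs : 1 - s / 2 ≤ α) {φ : X → ℝ}
    (hφ : MemLv (expWeight V) φ) {p : ℕ} (hpn : p ≤ n) :
    ∃ c : ℝ, ∀ x, |normOp F μ p n φ x - c * normOp F μ p n (fun _ => 1) x| ≤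
      α ^ (n - p) * (vNorm (expWeight V) φ / β) *
        (normOp F μ p n (fun _ => 1) x + β * expWeight V x) := by
  have hV := hD.measurable_V
  have hv := expWeight_pos V
  have hN := vNorm_nonneg hv φ
  have hφi : ∀ {η : Measure X}, Integrable (expWeight V) η → Integrable φ η := fun hη =>
    integrable_of_abs_le_mul hη hφ.1.aestronglyMeasurable (abs_le_vNorm_mul hv hφ)
  induction hpn using Nat.decreasingInduction with
  | self =>
    refine ⟨0, fun x => ?_⟩
    rw [normOp_self n hφ.1, normOp_self n measurable_const]
    have h1 : 0 ≤ vNorm (expWeight V) φ / β := by positivity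
    have h2 : vNorm (expWeight V) φ / β * (1 + β * expWeight V x) =
        vNorm (expWeight V) φ / β + vNorm (expWeight V) φ * expWeight V x := by
      field_simp
    simp only [zero_mul, sub_zero, tsub_self, pow_zero, one_mul]
    rw [h2]
    linarith [abs_le_vNorm_mul hv hφ x]
  | of_succ p hpn ih =>
    obtain ⟨c, hc⟩ := ih
    have hlp : 0 < F.lam μ p := hl.trans_le (hlam p)
    have hone : ∀ x, Integrable (fun _ : X => (1 : ℝ)) (F.semigroup p n x) := fun x =>
      hD.integrable_one (hD.integrable_semigroup hpn.le x)
    have hhi := fun x => integrable_normOp_Q (μ := μ) hpn (hone x)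
    have hh' := fun x => lam_mul_normOp hpn hlp.ne' (hone x)
    have hnonneg : ∀ y, 0 ≤ normOp F μ (p + 1) n (fun _ => 1) y := fun y =>
      div_nonneg (semigroupOp_one_nonneg F _ _ _)
        (Finset.prod_nonneg fun q _ => hl.le.trans (hlam q))
    have hret : ∀ {e : ℝ}, r ≤ e → ∀ x ∈ sublevel V e, returnMass V εm ν r e * (1 / D) ≤
        F.lam μ p * normOp F μ p n (fun _ => 1) x := fun {e} he x hx => by
      rw [hh']
      exact hm.returnMass_mul_le_integral hV hr he p hx hnonneg (hhi x) (by positivity)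
        (hlow (p + 1) hpn)
    -- Every `x` lies in the sublevel set of level `max r (V x)`, from which `C_r` is reached with
    -- positive mass.
    have hpos : ∀ x, 0 < normOp F μ p n (fun _ => 1) x := fun x => by
      have h1 := hret (le_max_left r (V x)) x (le_max_right r (V x))
      have h2 := hm.returnMass_pos hr (le_max_left r (V x))
      exact pos_of_mul_pos_right ((by positivity : (0 : ℝ) < _ * (1 / D)).trans_le h1) hlp.le
    have hupint : ∀ x, F.lam μ p * normOp F μ p n (fun _ => 1) x ≤
        D * ∫ y, expWeight V y ∂(F.Q (p + 1) x) := fun x => by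
      rw [hh', ← integral_const_mul]
      exact integral_mono (hhi x) ((hD.integrable_Q p x).const_mul D) (hup (p + 1) hpn)
    have hdrift : ∀ x, ∫ y, expWeight V y ∂(F.Q (p + 1) x) ≤
        F.lam μ p * (expWeight V x / 2 + K * normOp F μ p n (fun _ => 1) x) := fun x => by
      have h0 := mul_le_mul_of_nonneg_right (hlam p) (hv x).le
      have h00 := mul_nonneg hlp.le (hv x).le
      by_cases hx : x ∈ sublevel V d
      · have h1 := hD.integral_Q_le (hr.trans hd) p x
        have h2 : expWeight V x ≤ Real.exp d := Real.exp_le_exp.2 hx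
        have h3 := mul_le_mul_of_nonneg_left h2 (Real.exp_pos |b d|).le
        have h4 := mul_le_mul_of_nonneg_left (hret hd x hx) hK
        linarith
      · have h1 := hD.integral_Q_le_of_notMem (hr.trans hd) p hx
        have h2 := mul_le_mul_of_nonneg_right hκ (hv x).le
        have h3 := mul_nonneg hK (mul_nonneg hlp.le (hpos x).le)
        linarith
    -- `λ_p h_{p,n} ≤ D Q(v)` and the drift make `h_{p,n}` of order `e^{-δV} v`; it can be
    -- comparable to `v` only where `V` is bounded.
    have hnear : ∀ x, expWeight V x < 16 * K * normOp F μ p n (fun _ => 1) x →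
        x ∈ sublevel V d' := fun x hx => by
      have h1 := hD.integral_Q_le_exp le_rfl p x
      have h2 := mul_le_mul_of_nonneg_left
        ((hupint x).trans (mul_le_mul_of_nonneg_left h1 hDpos.le))
        (show 0 ≤ 16 * K by positivity)
      have h3 := mul_le_mul_of_nonneg_right (hlam p) (hv x).le
      have h4 := mul_lt_mul_of_pos_left hx hlp
      have h5 := mul_le_mul_of_nonneg_right hd'K (Real.exp_pos (V x * (1 - δ))).le
      have h6 : l * expWeight V x < l * (Real.exp (δ * d') * Real.exp (V x * (1 - δ))) := by
        linarith
      rw [← Real.exp_add] at h6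
      have h7 := Real.exp_lt_exp.1 (lt_of_mul_lt_mul_left h6 hl.le)
      have h8 : δ * V x < δ * d' := by linarith
      exact (lt_of_mul_lt_mul_left h8 hD.delta_pos.le).le
    have hmin : ∀ x, expWeight V x < 16 * K * normOp F μ p n (fun _ => 1) x →
        ENNReal.ofReal (εm d') • (ν d').restrict (sublevel V d') ≤ F.Q (p + 1) x ∧
          s * normOp F μ p n (fun _ => 1) x * F.lam μ p ≤
            ∫ y, normOp F μ (p + 1) n (fun _ => 1) y
              ∂(ENNReal.ofReal (εm d') • (ν d').restrict (sublevel V d')) := fun x hx => by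
      have hxd := hnear x hx
      have hle := hm.smul_restrict_le (hr.trans hd') p hxd
      refine ⟨hle, ?_⟩
      have hεm := hm.eps_pos d' (hr.trans hd')
      have := (hm.nu_mem d' (hr.trans hd')).1
      have h1 := hD.integral_Q_le le_rfl p x
      have h2 : expWeight V x ≤ Real.exp d' := Real.exp_le_exp.2 hxd
      have h3 : F.lam μ p * normOp F μ p n (fun _ => 1) x ≤
          D * (Real.exp |b d₀| * Real.exp d') := (hupint x).trans (by gcongr; exact h1.trans (by gcongr))
      have h4 := mul_le_mul_of_nonneg_left h3 hs
      have hi := (hhi x).mono_measure hle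
      have hi' : Integrable (normOp F μ (p + 1) n (fun _ => 1))
          ((ν d').restrict (sublevel V d')) :=
        (integrable_smul_measure (by simpa using hεm) ENNReal.ofReal_ne_top).1 hi
      have h5 : returnMass V εm ν r d' * (1 / D) ≤ εm d' *
          ∫ y in sublevel V d', normOp F μ (p + 1) n (fun _ => 1) y ∂(ν d') := by
        rw [returnMass, mul_assoc]
        gcongr
        calc (ν d').real (sublevel V r) * (1 / D)
            = ∫ _ in sublevel V r, 1 / D ∂(ν d') := by rw [setIntegral_const, smul_eq_mul]
          _ ≤ ∫ y in sublevel V r, normOp F μ (p + 1) n (fun _ => 1) y ∂(ν d') :=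
              setIntegral_mono_on (integrable_const _).integrableOn
                (IntegrableOn.mono_set hi' (sublevel_mono V hd')) (measurableSet_sublevel hV r)
                (hlow (p + 1) hpn)
          _ ≤ _ := setIntegral_mono_set hi' (.of_forall hnonneg)
              (sublevel_mono V hd').eventuallyLE
      rw [integral_smul_measure, ENNReal.toReal_ofReal hεm.le, smul_eq_mul]
      linarith
    obtain ⟨c', hc'⟩ := exists_abs_sub_mul_le_of_drift_of_minorization hv (hD.integrable_Q p) hhi
      (fun x => integrable_normOp_Q hpn (hφi (hD.integrable_semigroup hpn.le x))) hlp hh'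
      (fun x => lam_mul_normOp hpn hlp.ne' (hφi (hD.integrable_semigroup hpn.le x))) hpos hdrift
      hmin hβ.le hβK hα hαs (by positivity) hc
    refine ⟨c', fun x => (hc' x).trans_eq ?_⟩
    rw [show n - p = n - (p + 1) + 1 by lia, pow_succ]
    ring

/-- A contraction modulo multiples of `h_{p,n}` gives the centred bound. -/
lemma abs_normOp_sub_integral_eta_le (hD : DriftCondition F V δ d₀ b)
    (hμ : MemPv (expWeight V) μ) {B D β C : ℝ}
    (hpos : ∀ n, 0 < (F.gamma μ n).real Set.univ)
    (hγ : ∀ n, ∫ y, expWeight V y ∂(F.gamma μ n) ≤ B * (F.gamma μ n).real Set.univ)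
    {p n : ℕ} (hpn : p ≤ n) (hB : 0 ≤ B) (hβ : 0 ≤ β) (hC : 0 ≤ C)
    (hup : ∀ x, normOp F μ p n (fun _ => 1) x ≤ D * expWeight V x) {φ : X → ℝ}
    (hφ : Integrable φ (F.gamma μ n)) {c : ℝ}
    (hc : ∀ x, |normOp F μ p n φ x - c * normOp F μ p n (fun _ => 1) x| ≤
      C * (normOp F μ p n (fun _ => 1) x + β * expWeight V x)) (x : X) :
    |normOp F μ p n φ x - normOp F μ p n (fun _ => 1) x * ∫ y, φ y ∂(F.eta μ n)| ≤
      C * (2 * D + β + D * (β * B)) * expWeight V x := by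
  have hone := hD.integrable_one (hD.integrable_gamma hμ n)
  have hfi := integrable_eta (hpos p) (integrable_normOp_gamma hpn hφ)
  have hhi := integrable_eta (hpos p) (integrable_normOp_gamma hpn hone)
  have hvi := integrable_eta (hpos p) (hD.integrable_gamma hμ p)
  have hh1 : ∫ y, normOp F μ p n (fun _ => 1) y ∂(F.eta μ p) = 1 := by
    rw [integral_normOp_eta hD hμ hpos hpn hone, integral_eta]
    simp [(hpos n).ne']
  have hvB : ∫ y, expWeight V y ∂(F.eta μ p) ≤ B := by
    rw [integral_eta, div_le_iff₀ (hpos p)]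
    exact hγ p
  -- Integrate `hc` against `η_p`: the left side becomes `η_n(φ) - c`.
  have hdiff : |(∫ y, φ y ∂(F.eta μ n)) - c| ≤ C * (1 + β * B) := by
    rw [← integral_normOp_eta hD hμ hpos hpn hφ, ← mul_one c, ← hh1, ← integral_const_mul,
      ← integral_sub hfi (hhi.const_mul c), ← Real.norm_eq_abs]
    refine (norm_integral_le_of_norm_le ((hhi.add (hvi.const_mul β)).const_mul C)
      (.of_forall hc)).trans ?_
    rw [integral_const_mul]
    simp only [Pi.add_apply]
    rw [integral_add hhi (hvi.const_mul β), integral_const_mul, hh1]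
    gcongr
  have hh0 : 0 ≤ normOp F μ p n (fun _ => 1) x := by
    rw [normOp, prod_lam_eq hD hμ hpos hpn]
    exact div_nonneg (semigroupOp_one_nonneg F _ _ _) (div_nonneg (hpos n).le (hpos p).le)
  calc |normOp F μ p n φ x - normOp F μ p n (fun _ => 1) x * ∫ y, φ y ∂(F.eta μ n)|
      = |(normOp F μ p n φ x - c * normOp F μ p n (fun _ => 1) x) -
          normOp F μ p n (fun _ => 1) x * ((∫ y, φ y ∂(F.eta μ n)) - c)| := by congr 1; ring
    _ ≤ |normOp F μ p n φ x - c * normOp F μ p n (fun _ => 1) x| +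
          normOp F μ p n (fun _ => 1) x * |(∫ y, φ y ∂(F.eta μ n)) - c| := by
        refine (abs_sub _ _).trans_eq ?_
        rw [abs_mul, abs_of_nonneg hh0]
    _ ≤ C * (normOp F μ p n (fun _ => 1) x + β * expWeight V x) +
          normOp F μ p n (fun _ => 1) x * (C * (1 + β * B)) :=
        add_le_add (hc x) (mul_le_mul_of_nonneg_left hdiff hh0)
    _ = C * (normOp F μ p n (fun _ => 1) x * (2 + β * B) + β * expWeight V x) := by ring
    _ ≤ C * (D * expWeight V x * (2 + β * B) + β * expWeight V x) := by
        gcongr; exact hup x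
    _ = _ := by ring

end Normalised

/-! ### Choice of the constants and conclusion. -/

lemma exists_ge_exp_neg_mul_le {δ ε : ℝ} (hδ : 0 < δ) (hε : 0 < ε) (r : ℝ) :
    ∃ d, r ≤ d ∧ Real.exp (-(δ * d)) ≤ ε := by
  refine ⟨max r (-Real.log ε / δ), le_max_left _ _, ?_⟩
  rw [← Real.le_log_iff_exp_le hε]
  have := (div_le_iff₀' hδ).1 (le_max_right r (-Real.log ε / δ))
  linarith

lemma exists_sublevel_real_pos {X : Type*} [MeasurableSpace X] (V : X → ℝ) (μ : Measure X)
    [IsProbabilityMeasure μ] (d₀ : ℝ) : ∃ r, d₀ ≤ r ∧ 0 < μ.real (sublevel V r) := by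
  by_contra! h
  have h0 : ∀ k : ℕ, μ (sublevel V (d₀ + k)) = 0 := fun k =>
    (measureReal_eq_zero_iff).1 ((h (d₀ + k) (by simp)).antisymm measureReal_nonneg)
  have hU : (⋃ k : ℕ, sublevel V (d₀ + k)) = Set.univ := by
    refine Set.eq_univ_of_forall fun x => Set.mem_iUnion.2 ?_
    obtain ⟨k, hk⟩ := exists_nat_ge (V x - d₀)
    exact ⟨k, show V x ≤ d₀ + k by linarith⟩
  have := measure_iUnion_null h0
  rw [hU, measure_univ] at this
  exact one_ne_zero this

theorem theorem3 {X : Type*} [TopologicalSpace X] [PolishSpace X] [NoncompactSpace X]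
    [MeasurableSpace X] [BorelSpace X]
    (V : X → ℝ) (δ d₀ : ℝ) (b εm εp : ℝ → ℝ) (ν : ℝ → Measure X) (μ : Measure X) :
    ∃ ρ c : ℝ, 0 ≤ ρ ∧ ρ < 1 ∧
      ∀ F : FKModel X,
        DriftCondition F V δ d₀ b →
        MemPv (expWeight V) μ →
        MinorizationCondition F V d₀ εm ν →
        MajorizationCondition F V d₀ εm ν εp →
        (∀ n, 0 < F.lam μ n) ∧
        ∀ φ : X → ℝ, MemLv (expWeight V) φ → ∀ n p : ℕ, 1 ≤ n → p < n → ∀ x : X,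
          Integrable φ (F.semigroup p n x) ∧ Integrable φ (F.eta μ n) ∧
          |F.semigroupOp p n φ x / (∏ q ∈ Finset.Ico p n, F.lam μ q)
              - F.h μ p n x * ∫ y, φ y ∂(F.eta μ n)|
            ≤ ρ ^ (n - p) * vNorm (expWeight V) φ * c * expWeight V x
                * ∫ y, expWeight V y ∂μ := by
  -- The positivity facts behind the constants come from the hypotheses; if no model satisfies
  -- these, any constants do.
  by_cases hex : ∃ F : FKModel X, DriftCondition F V δ d₀ b ∧ MemPv (expWeight V) μ ∧
      MinorizationCondition F V d₀ εm ν
  swap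
  · exact ⟨0, 0, le_rfl, one_pos, fun F h1 h2 h3 => absurd ⟨F, h1, h2, h3⟩ hex⟩
  -- The constants are chosen from facts that do not depend on the model `F₀`.
  obtain ⟨F₀, hD₀, hμ, hm₀⟩ := hex
  have hδ := hD₀.delta_pos
  have := hμ.1
  obtain ⟨r, hr, hμr⟩ := exists_sublevel_real_pos V μ d₀
  have hμv : 1 ≤ ∫ y, expWeight V y ∂μ := by
    simpa [F₀.gamma_zero] using real_univ_gamma_le hD₀ hμ 0
  have hθ := hm₀.returnMass_pos hr le_rfl
  set θ := returnMass V εm ν r r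
  -- The levels serve in turn: `d₁` for the flow, `d₂` for the total masses, `d₃` for the drift
  -- relative to `h`, `d₄` for the minorization. Each uses only constants already fixed.
  obtain ⟨d₁, hd₁, hκ₁⟩ := exists_ge_exp_neg_mul_le hδ (half_pos hθ) r
  have hm₁ := hm₀.returnMass_pos hr hd₁
  obtain ⟨B, hB, hB1, hB2⟩ : ∃ B : ℝ, 0 < B ∧
      2 * (Real.exp |b d₁| * Real.exp d₁) ≤ B * returnMass V εm ν r d₁ ∧
      ∫ y, expWeight V y ∂μ ≤ B * μ.real (sublevel V r) :=
    ⟨max (2 * (Real.exp |b d₁| * Real.exp d₁) / returnMass V εm ν r d₁)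
      ((∫ y, expWeight V y ∂μ) / μ.real (sublevel V r)), lt_max_of_lt_left (by positivity),
      (div_le_iff₀ hm₁).1 (le_max_left _ _), (div_le_iff₀ hμr).1 (le_max_right _ _)⟩
  set E := Real.exp |b d₀|
  have hE : 0 < E := Real.exp_pos _
  obtain ⟨k, hk0, hk1, hkE⟩ : ∃ k : ℝ, 0 < k ∧ k ≤ 1 ∧ 2 * (k * E) ≤ θ := by
    refine ⟨min 1 (θ / (2 * E)), lt_min one_pos (by positivity), min_le_left _ _, ?_⟩
    have := (le_div_iff₀ (by positivity)).1 (min_le_right 1 (θ / (2 * E)))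
    linarith
  obtain ⟨d₂, hd₂, hκ₂⟩ := exists_ge_exp_neg_mul_le hδ (mul_pos hk0 hθ) r
  have hε₂ := hm₀.eps_pos d₂ (hr.trans hd₂)
  obtain ⟨A, hA, hkA, hAε⟩ : ∃ A : ℝ, 0 < A ∧ 1 ≤ k * A ∧ 2 * εp d₂ ≤ A * εm d₂ :=
    ⟨max (1 / k) (2 * εp d₂ / εm d₂), lt_max_of_lt_left (by positivity),
      (div_le_iff₀' hk0).1 (le_max_left _ _), (div_le_iff₀ hε₂).1 (le_max_right _ _)⟩
  obtain ⟨D, hDdef⟩ : ∃ D, D = A * B := ⟨_, rfl⟩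
  have hDpos : 0 < D := hDdef ▸ mul_pos hA hB
  have hl : 0 < θ / B := div_pos hθ hB
  obtain ⟨d₃, hd₃, hκ₃⟩ := exists_ge_exp_neg_mul_le hδ (half_pos hl) r
  have hm₃ := hm₀.returnMass_pos hr hd₃
  obtain ⟨K, hK, hKd⟩ : ∃ K : ℝ, 0 < K ∧
      Real.exp |b d₃| * Real.exp d₃ ≤ K * (returnMass V εm ν r d₃ * (1 / D)) :=
    ⟨Real.exp |b d₃| * Real.exp d₃ / (returnMass V εm ν r d₃ * (1 / D)), by positivity,
      (div_mul_cancel₀ _ (by positivity)).ge⟩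
  obtain ⟨d₄, hd₄, hd₄K⟩ : ∃ d, r ≤ d ∧ 16 * K * (D * E) ≤ θ / B * Real.exp (δ * d) := by
    obtain ⟨d, hd, h⟩ := exists_ge_exp_neg_mul_le hδ
      (show 0 < θ / B / (16 * K * (D * E)) by positivity) r
    refine ⟨d, hd, ?_⟩
    rw [Real.exp_neg, le_div_iff₀ (by positivity), inv_mul_le_iff₀ (Real.exp_pos _)] at h
    linarith
  have hm₄ := hm₀.returnMass_pos hr hd₄
  obtain ⟨s, hs, hsd⟩ : ∃ s : ℝ, 0 < s ∧
      s * (D * (E * Real.exp d₄)) ≤ returnMass V εm ν r d₄ * (1 / D) :=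
    ⟨returnMass V εm ν r d₄ * (1 / D) / (D * (E * Real.exp d₄)), by positivity,
      (div_mul_cancel₀ _ (by positivity)).le⟩
  obtain ⟨β, hβ, hβK⟩ : ∃ β : ℝ, 0 < β ∧ β * K = s / 2 :=
    ⟨s / 2 / K, by positivity, div_mul_cancel₀ _ hK.ne'⟩
  have hα0 : (0 : ℝ) ≤ max (3 / 4) (1 - s / 2) := le_max_of_le_left (by norm_num)
  refine ⟨max (3 / 4) (1 - s / 2), (2 * D + β + D * (β * B)) / β, hα0,
    max_lt (by norm_num) (by linarith), fun F hD _ hm hM => ?_⟩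
  have hγ := integral_gamma_le_mul_real hD hμ hm hr hd₁ hκ₁ hB.le hB1 hB2 hμr
  have hfin : ∀ n, IsFiniteMeasure (F.gamma μ n) := fun n =>
    hD.isFiniteMeasure_of_integrable (hD.integrable_gamma hμ n)
  have hγ' : ∀ n, (F.gamma μ n).real (sublevel V r) ≤ (F.gamma μ n).real Set.univ := fun n =>
    measureReal_mono (Set.subset_univ _)
  have hpos : ∀ n, 0 < (F.gamma μ n).real Set.univ := fun n => (hγ n).2.trans_le (hγ' n)
  have hlam := le_lam hD hμ hm hr hB hγ
  refine ⟨fun n => hl.trans_le (hlam n), fun φ hφ n p _ hpn x => ?_⟩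
  have hφi : ∀ {η : Measure X}, Integrable (expWeight V) η → Integrable φ η := fun hη =>
    integrable_of_abs_le_mul hη hφ.1.aestronglyMeasurable
      (abs_le_vNorm_mul (expWeight_pos V) hφ)
  have hφn := hφi (hD.integrable_gamma hμ n)
  refine ⟨hφi (hD.integrable_semigroup hpn.le x), integrable_eta (hpos n) hφn, ?_⟩
  have hbd : ∀ q ≤ n, (∀ x ∈ sublevel V r, 1 / D ≤ normOp F μ q n (fun _ => 1) x) ∧
      ∀ x, normOp F μ q n (fun _ => 1) x ≤ D * expWeight V x := fun q hq => by
    obtain ⟨j, hj, hlow, hup, -⟩ :=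
      exists_semigroupOp_one_bounds hD hm hM hr hd₂ hk0 hk1 hκ₂ hkE hkA hAε hq
    rw [hDdef]
    exact normOp_one_bounds hD hμ hA hB hj hγ hq hlow hup
  obtain ⟨c, hc⟩ := exists_abs_normOp_sub_le hD hm hr hd₃ hd₄ hl hlam hDpos
    (fun q hq => (hbd q hq).1) (fun q hq => (hbd q hq).2) hκ₃ hK.le hKd hd₄K hs.le hsd hβ hβK
    (le_max_left (3 / 4) (1 - s / 2)) (le_max_right _ _) hφ hpn.le
  have hN := vNorm_nonneg (expWeight_pos V) φ
  have hv := expWeight_pos V x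
  have hmain := abs_normOp_sub_integral_eta_le hD hμ hpos
    (fun n => (hγ n).1.trans (mul_le_mul_of_nonneg_left (hγ' n) hB.le)) hpn.le hB.le hβ.le
    (by positivity) (hbd p hpn.le).2 hφn hc x
  -- `F.h μ p n x` unfolds to `normOp F μ p n (fun _ => 1) x`.
  refine hmain.trans ?_
  -- The bound holds without the factor `μ(v)`, which is at least `1`.
  refine le_trans (le_of_eq ?_) (le_mul_of_one_le_right (by positivity) hμv)
  ring
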